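/- Let $N\ge 2$, let $\sigma,E_s,\sigma_\eta>0$, and let $x_0,\dots,x_N,y_0,\dots,y_N$ be independent real Gaussian random variables with mean $0$ and variance $\tfrac12$. Let $\mu_2,\dots,\mu_N$ be real numbers with $|\mu_k|<1$. The channels at the $N$ ports of a fluid antenna system are $$g_1=\sigma x_0+j\sigma y_0,\qquad g_k=\sigma\Big(\sqrt{1-\mu_k^2}\,x_k+\mu_kx_0\Big)+j\sigma\Big(\sqrt{1-\mu_k^2}\,y_k+\mu_ky_0\Big)\quad(2\le k\le N).$$ Put $\Theta=E_s/\sigma_\eta^2$ (symbol energy over noise variance) and $\Gamma=\sigma^2\Theta$ (the average received SNR). For a threshold $\gamma>0$ the outage probability is $p^{N}_{\rm out}(\gamma)=\Pr\big(\max_{1\le k\le N}|g_k|^2\,\Theta<\gamma\big)$. For $\kappa>1$ let $$\varrho=\frac{e^{1/(\pi(\kappa-1)+2)}}{2\kappa}\sqrt{\frac{(\kappa-1)(\pi(\kappa-1)+2)}{\pi}},\qquad f_k(\gamma)=1-\frac{\varrho}{\sqrt{|\mu_k|}}\,e^{-\frac{\kappa}{1-\mu_k^2}\frac{\gamma}{\Gamma}}\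 \ (\mu_k\neq0),\qquad \tilde f_k(\gamma)=1-\varrho\, e^{-\frac{\kappa}{1-\mu_k^2}\frac{\gamma}{\Gamma}},$$ $$p^{\rm UB}_{\rm out}(\gamma)=\big(1-e^{-\gamma/\Gamma}\big)\prod_{k=2}^N f_k(\gamma).$$ Then, for every $\kappa>1$: 1. $0<\varrho<\tfrac12$. 2. If all $\mu_k$ are nonzero and the factors are positive at every threshold, that is, $f_k(\gamma')>0$ for all $\gamma'>0$ and $2\le k\le N$ (equivalently $|\mu_k|\ge\varrho^2$ for all $k$), then $p^{N}_{\rm out}(\gamma)<p^{\rm UB}_{\rm out}(\gamma)$ for all $\gamma>0$. 3. If all $\mu_k$ are nonzero, then $p^{N}_{\rm out}(\gamma)<p^{\rm UB}_{\rm out}(\gamma)$ also holds at every single threshold $\gamma>0$ that is large enough in the sense that $\frac{\kappa-1}{1-\mu_k^2}\cdot\frac{\gamma}{\Gamma}\ge\ln\frac{\varrho}{\sqrt{|\mu_k|}}$ for all $2\le k\le N$. 4. If $S$ is any set of ports such that every port $k\in\{2,\dots,N\}\setminus S$ has $\mu_k\ne0$ and $f_k(\gamma')>0$ for all $\gamma'>0$,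 then for all $\gamma>0$ $$p^{N}_{\rm out}(\gamma)<\big(1-e^{-\gamma/\Gamma}\big)\prod_{\substack{2\le k\le N\\k\in S}}\tilde f_k(\gamma)\prod_{\substack{2\le k\le N\\k\notin S}}f_k(\gamma).$$ 5. Under the hypothesis of 2, for all $\gamma>0$: $p^{2}_{\rm out}(\gamma)\prod_{k=3}^N f_k(\gamma)<p^{\rm UB}_{\rm out}(\gamma)$, and, if $N\ge3$, $p^{N}_{\rm out}(\gamma)<p^{2}_{\rm out}(\gamma)\prod_{k=3}^N f_k(\gamma)$. Here $p^2_{\rm out}$ is the outage probability of the system that consists of ports $1$ and $2$ only. -/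

import Mathlib

open MeasureTheory ProbabilityTheory

noncomputable section

namespace FluidAntenna

/-- The underlying randomness of an `N`-port fluid antenna: `x 0, …, x N, y 0, …, y N` are
independent real Gaussians with mean `0` and variance `1 / 2`. Only indices up to `N` matter. -/
structure IsGaussianSource {Ω : Type*} [MeasurableSpace Ω] (P : Measure Ω) (N : ℕ)
    (x y : ℕ → Ω → ℝ) : Prop where
  law_x : ∀ k ≤ N, HasLaw (x k) (gaussianReal 0 (1 / 2)) P
  law_y : ∀ k ≤ N, HasLaw (y k) (gaussianReal 0 (1 / 2)) P
  indep : iIndepFun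
    (Sum.elim (fun k : Fin (N + 1) => x k) (fun k : Fin (N + 1) => y k)) P

/-- The complex channel coefficient at port `k` (ports are numbered from `1`; port `1` is the
reference port). -/
def channel {Ω : Type*} (σ : ℝ) (μ : ℕ → ℝ) (x y : ℕ → Ω → ℝ) (k : ℕ) (ω : Ω) : ℂ :=
  if k = 1 then
    ⟨σ * x 0 ω, σ * y 0 ω⟩
  else
    ⟨σ * (√(1 - μ k ^ 2) * x k ω + μ k * x 0 ω),
      σ * (√(1 - μ k ^ 2) * y k ω + μ k * y 0 ω)⟩

/-- `|g_FAS| = max {|g_1|, …, |g_N|}`, for `1 ≤ N`. -/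
def gFAS {Ω : Type*} (N : ℕ) (σ : ℝ) (μ : ℕ → ℝ) (x y : ℕ → Ω → ℝ) (ω : Ω) : ℝ :=
  ⨆ k : Set.Icc 1 N, ‖channel σ μ x y k ω‖

/-- The transmit signal-to-noise ratio `Θ`: symbol energy `Es` over noise variance `ση ^ 2`. -/
def transmitSNR (Es ση : ℝ) : ℝ := Es / ση ^ 2

/-- The average received signal-to-noise ratio `Γ = σ ^ 2 * Θ` at each port. -/
def avgSNR (σ Es ση : ℝ) : ℝ := σ ^ 2 * transmitSNR Es ση

/-- The outage probability of the `N`-port fluid antenna: the probability that the received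
signal-to-noise ratio at the best port is below the threshold `γ`. -/
def outageProb {Ω : Type*} [MeasurableSpace Ω] (P : Measure Ω) (N : ℕ) (σ Es ση : ℝ)
    (μ : ℕ → ℝ) (x y : ℕ → Ω → ℝ) (γ : ℝ) : ℝ :=
  P.real {ω | gFAS N σ μ x y ω ^ 2 * transmitSNR Es ση < γ}

/-- The explicit constant `ϱ`, as a function of `κ > 1`. -/
def rho (κ : ℝ) : ℝ :=
  Real.exp (1 / (Real.pi * (κ - 1) + 2)) / (2 * κ)
    * √((κ - 1) * (Real.pi * (κ - 1) + 2) / Real.pi)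

/-- The factor contributed by a port with autocorrelation parameter `m`, where `X` is the
threshold relative to the average signal-to-noise ratio. Meaningful for `0 < |m| < 1`. -/
def portFactor (κ m X : ℝ) : ℝ :=
  1 - rho κ / √|m| * Real.exp (-(κ / (1 - m ^ 2) * X))

/-- The modified factor, used for ports whose autocorrelation parameter is close to zero. -/
def modifiedPortFactor (κ m X : ℝ) : ℝ :=
  1 - rho κ * Real.exp (-(κ / (1 - m ^ 2) * X))

/-- The upper bound for an `N`-port fluid antenna. -/
def outageUB (κ : ℝ) (N : ℕ) (μ : ℕ → ℝ) (X : ℝ) : ℝ :=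
  (1 - Real.exp (-X)) * ∏ k ∈ Finset.Icc 2 N, portFactor κ (μ k) X

/-- The upper bound in which the factors of the ports in `S` are replaced by the modified ones. -/
def modifiedOutageUB (κ : ℝ) (N : ℕ) (S : Finset ℕ) (μ : ℕ → ℝ) (X : ℝ) : ℝ :=
  (1 - Real.exp (-X)) *
    ∏ k ∈ Finset.Icc 2 N,
      if k ∈ S then modifiedPortFactor κ (μ k) X else portFactor κ (μ k) X

end FluidAntenna

end

/-!
In units of the average gain, port `1` has gain `|Z₀| ^ 2` and port `k` has gain
`|√(1 - μ_k ^ 2) Z_k + μ_k Z₀| ^ 2`, where the `Z_k` are independent standard circular complex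
Gaussians. Conditionally on `Z₀`, port `k` is in outage if `Z_k` falls into a disc of squared radius
`X / (1 - μ_k ^ 2)` whose centre is a multiple of `Z₀`. Among all discs of a given radius the centred
one has the largest Gaussian measure, strictly (`planarGaussian_disc_lt`), and that measure is
`1 - exp (-X / (1 - μ_k ^ 2))` (`planarGaussian_disc_zero`). Since `Z_k` is independent of the pairs
with smaller index, adding port `k` multiplies the outage probability by at most this number, and by
strictly less if `μ_k ≠ 0` (`IsGaussianSource.outage_succ_bounds`).

It remains to compare `1 - exp (-X / (1 - μ_k ^ 2))` with the explicit factors. The condition on a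
large threshold says exactly that it is at most the factor of port `k`
(`le_portFactor_of_log_le`). Positivity of that factor at all thresholds forces `ϱ ≤ √|μ_k|`, so
that `κ > 1` makes the inequality strict (`lt_portFactor_of_pos`); for the modified factor `ϱ < 1`
suffices (`lt_modifiedPortFactor`).
-/

namespace FluidAntenna

/-! ### The constant `ϱ` -/

theorem rho_pos {κ : ℝ} (hκ : 1 < κ) : 0 < rho κ := by
  have hπ := Real.pi_pos
  have h1 : 0 < κ - 1 := sub_pos.2 hκ
  unfold rho
  positivity

/-- With `u = π (κ - 1) + 2`, squaring turns `2 ϱ < 1` into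
`exp (2 / u) * (u * (u - 2)) < (u + π - 2) ^ 2`. This holds because `1 - v ≤ exp (-v)` at `v = 2 / u`
bounds the left-hand side by `u ^ 2`, and `π > 2`. -/
theorem rho_lt_half {κ : ℝ} (hκ : 1 < κ) : rho κ < 1 / 2 := by
  have hπ := Real.pi_gt_three
  have h1 : 0 < κ - 1 := sub_pos.2 hκ
  unfold rho
  set u := Real.pi * (κ - 1) + 2 with hu
  have hu2 : 2 < u := by have := mul_pos Real.pi_pos h1; linarith
  have hexp : Real.exp (1 / u) ^ 2 * (u - 2) ≤ u := by
    have h := Real.add_one_le_exp (-(2 / u))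
    have h2 : Real.exp (1 / u) ^ 2 * Real.exp (-(2 / u)) = 1 := by
      rw [← Real.exp_nat_mul, ← Real.exp_add]
      norm_num
      ring
    have h3 := mul_le_mul_of_nonneg_left h (sq_nonneg (Real.exp (1 / u)))
    rw [h2] at h3
    have h4 := mul_le_mul_of_nonneg_right h3 (by linarith : (0 : ℝ) ≤ u)
    calc Real.exp (1 / u) ^ 2 * (u - 2)
        = Real.exp (1 / u) ^ 2 * (-(2 / u) + 1) * u := by
          field_simp
          ring
      _ ≤ 1 * u := h4
      _ = u := one_mul u
  have hkey : Real.exp (1 / u) * √((κ - 1) * u / Real.pi) < κ := by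
    refine lt_of_pow_lt_pow_left₀ 2 (by linarith) ?_
    rw [mul_pow, Real.sq_sqrt (by positivity)]
    have hk : κ - 1 = (u - 2) / Real.pi := by
      rw [hu]; field_simp; ring
    have hk' : κ = (u + Real.pi - 2) / Real.pi := by
      rw [hu]; field_simp; ring
    calc Real.exp (1 / u) ^ 2 * ((κ - 1) * u / Real.pi)
        = (Real.exp (1 / u) ^ 2 * (u - 2)) * u / Real.pi ^ 2 := by
          rw [hk]; field_simp
      _ ≤ u * u / Real.pi ^ 2 := by gcongr
      _ < (u + Real.pi - 2) ^ 2 / Real.pi ^ 2 := by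
          gcongr
          nlinarith
      _ = κ ^ 2 := by rw [← div_pow, ← hk']
  have hκ0 : 0 < κ := by linarith
  rw [div_mul_eq_mul_div, div_lt_div_iff₀ (by positivity) (by norm_num)]
  linarith

/-! ### The planar Gaussian measure of discs -/

/-- The law of a pair of independent centred Gaussians of variance `1 / 2`, that is, of a standard
circular complex Gaussian. -/
noncomputable def planarGaussian : Measure (ℝ × ℝ) :=
  (gaussianReal 0 (1 / 2)).prod (gaussianReal 0 (1 / 2))

instance : IsProbabilityMeasure planarGaussian := by
  unfold planarGaussian
  infer_instance

/-- The density of `planarGaussian` with respect to Lebesgue measure. -/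
noncomputable def planarDensity (z : ℝ × ℝ) : ℝ :=
  Real.pi⁻¹ * Real.exp (-(z.1 ^ 2 + z.2 ^ 2))

theorem planarDensity_nonneg (z : ℝ × ℝ) : 0 ≤ planarDensity z := by
  have := Real.pi_pos
  unfold planarDensity
  positivity

@[fun_prop]
theorem continuous_planarDensity : Continuous planarDensity := by
  unfold planarDensity
  fun_prop

theorem planarGaussian_eq_withDensity :
    planarGaussian = volume.withDensity fun z => ENNReal.ofReal (planarDensity z) := by
  have hv : (1 / 2 : NNReal) ≠ 0 := by norm_num
  unfold planarGaussian
  rw [gaussianReal_of_var_ne_zero _ hv,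
    prod_withDensity (measurable_gaussianPDF _ _) (measurable_gaussianPDF _ _)]
  congr 1
  funext z
  rw [gaussianPDF, gaussianPDF, ← ENNReal.ofReal_mul (gaussianPDFReal_nonneg _ _ _)]
  congr 1
  unfold gaussianPDFReal planarDensity
  have h : (2 * Real.pi * ((1 / 2 : NNReal) : ℝ)) = Real.pi := by push_cast; ring
  rw [h, mul_mul_mul_comm, ← Real.exp_add, ← mul_inv, Real.mul_self_sqrt Real.pi_pos.le]
  congr 2
  push_cast
  ring

theorem integrable_planarDensity : Integrable planarDensity := by
  refine ⟨by fun_prop, ?_⟩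
  rw [hasFiniteIntegral_iff_ofReal (.of_forall planarDensity_nonneg), ← setLIntegral_univ,
    ← withDensity_apply _ .univ, ← planarGaussian_eq_withDensity]
  exact measure_lt_top _ _

theorem planarGaussian_real_apply {s : Set (ℝ × ℝ)} (hs : MeasurableSet s) :
    planarGaussian.real s = ∫ z in s, planarDensity z := by
  rw [integral_eq_lintegral_of_nonneg_ae (.of_forall planarDensity_nonneg) (by fun_prop),
    measureReal_def, planarGaussian_eq_withDensity, withDensity_apply _ hs]

/-- The open disc with centre `c` and squared radius `R`. It is empty if `R ≤ 0`. -/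
def disc (c : ℝ × ℝ) (R : ℝ) : Set (ℝ × ℝ) :=
  {z | (z.1 - c.1) ^ 2 + (z.2 - c.2) ^ 2 < R}

theorem isOpen_disc (c : ℝ × ℝ) (R : ℝ) : IsOpen (disc c R) :=
  isOpen_lt (by fun_prop) (by fun_prop)

theorem integral_mul_exp_neg_sq (b : ℝ) :
    ∫ r in (0 : ℝ)..b, r * Real.exp (-r ^ 2) = (1 - Real.exp (-b ^ 2)) / 2 := by
  have h (r : ℝ) :
      HasDerivAt (fun r : ℝ => -Real.exp (-r ^ 2) / 2) (r * Real.exp (-r ^ 2)) r := by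
    have h1 : HasDerivAt (fun r : ℝ => -r ^ 2) (-(2 * r)) r := by
      simpa using! (hasDerivAt_pow 2 r).neg
    convert! (h1.exp.neg.div_const 2) using 1
    ring_nf
  rw [intervalIntegral.integral_eq_sub_of_hasDerivAt (fun r _ => h r)
    (Continuous.intervalIntegrable (by fun_prop) _ _)]
  simp
  ring

/-- The squared modulus of a standard circular complex Gaussian is exponentially distributed. -/
theorem planarGaussian_disc_zero {R : ℝ} (hR : 0 < R) :
    planarGaussian.real (disc 0 R) = 1 - Real.exp (-R) := by
  have hm : MeasurableSet (disc 0 R) := (isOpen_disc 0 R).measurableSet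
  rw [planarGaussian_real_apply hm, ← integral_indicator hm, ← integral_comp_polarCoord_symm]
  have hpt : ∀ p ∈ polarCoord.target,
      p.1 • (disc 0 R).indicator planarDensity (polarCoord.symm p)
        = (Set.Iio (√R)).indicator (fun r => r * Real.exp (-r ^ 2)) p.1 * Real.pi⁻¹ := by
    rintro ⟨r, θ⟩ hp
    have hr : 0 < r := hp.1
    have hsq : (r * Real.cos θ) ^ 2 + (r * Real.sin θ) ^ 2 = r ^ 2 := by
      linear_combination r ^ 2 * Real.cos_sq_add_sin_sq θ
    have hmem : polarCoord.symm (r, θ) ∈ disc 0 R ↔ r ∈ Set.Iio (√R) := by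
      simp [disc, hsq, Real.lt_sqrt hr.le]
    by_cases h : r ∈ Set.Iio (√R)
    · rw [Set.indicator_of_mem (hmem.2 h), Set.indicator_of_mem h]
      simp only [planarDensity, polarCoord_symm_apply, hsq, smul_eq_mul]
      ring
    · rw [Set.indicator_of_notMem (mt hmem.1 h), Set.indicator_of_notMem h]
      simp
  rw [setIntegral_congr_fun polarCoord.open_target.measurableSet hpt]
  have hprod := setIntegral_prod_mul (μ := (volume : Measure ℝ)) (ν := (volume : Measure ℝ))
    ((Set.Iio (√R)).indicator fun r => r * Real.exp (-r ^ 2)) (fun _ => Real.pi⁻¹)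
    (Set.Ioi (0 : ℝ)) (Set.Ioo (-Real.pi) Real.pi)
  rw [polarCoord_target]
  refine hprod.trans ?_
  rw [setIntegral_indicator measurableSet_Iio, Set.Ioi_inter_Iio, ← integral_Ioc_eq_integral_Ioo,
    ← intervalIntegral.integral_of_le (Real.sqrt_nonneg R), integral_mul_exp_neg_sq,
    Real.sq_sqrt hR.le, setIntegral_const, measureReal_def, Real.volume_Ioo,
    ENNReal.toReal_ofReal (by linarith [Real.pi_pos])]
  have := Real.pi_ne_zero
  simp only [smul_eq_mul]
  field_simp
  ring

theorem volume_disc_diff_pos {c : ℝ × ℝ} (hc : c ≠ 0) {R : ℝ} (hR : 0 < R) :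
    0 < volume (disc 0 R \ disc c R) := by
  have hm : 0 < c.1 ^ 2 + c.2 ^ 2 := by
    rcases not_and_or.1 (mt Prod.ext_iff.2 hc) with h | h
    · have : 0 < c.1 ^ 2 := by positivity [show c.1 ≠ 0 from h]
      positivity
    · have : 0 < c.2 ^ 2 := by positivity [show c.2 ≠ 0 from h]
      positivity
  set m := c.1 ^ 2 + c.2 ^ 2
  set u := √(R / m)
  have hu : 0 < u := Real.sqrt_pos.2 (by positivity)
  have hum : u ^ 2 * m = R := by
    rw [Real.sq_sqrt (by positivity)]
    field_simp
  have hopen : IsOpen (disc 0 R ∩ {z : ℝ × ℝ | R < (z.1 - c.1) ^ 2 + (z.2 - c.2) ^ 2}) :=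
    (isOpen_disc 0 R).inter (isOpen_lt (by fun_prop) (by fun_prop))
  -- The point `-t • c` lies in the open set as soon as `0 < t < u < 1 + t`.
  obtain ⟨t, ht0, htu, hut⟩ : ∃ t, 0 < t ∧ t < u ∧ u < 1 + t := by
    refine ⟨u ^ 2 / (1 + u), by positivity, ?_, ?_⟩
    · rw [div_lt_iff₀ (by positivity)]; nlinarith
    · rw [← sub_lt_iff_lt_add', lt_div_iff₀ (by positivity)]; nlinarith
  have hne : (disc 0 R ∩ {z : ℝ × ℝ | R < (z.1 - c.1) ^ 2 + (z.2 - c.2) ^ 2}).Nonempty := by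
    refine ⟨(-t * c.1, -t * c.2), ?_, ?_⟩
    · change (-t * c.1 - 0) ^ 2 + (-t * c.2 - 0) ^ 2 < R
      calc _ = t ^ 2 * m := by ring
        _ < u ^ 2 * m := by gcongr
        _ = R := hum
    · change R < (-t * c.1 - c.1) ^ 2 + (-t * c.2 - c.2) ^ 2
      calc R = u ^ 2 * m := hum.symm
        _ < (1 + t) ^ 2 * m := by gcongr
        _ = _ := by ring
  refine (hopen.measure_pos volume hne).trans_le (measure_mono ?_)
  rintro z ⟨h1, h2⟩
  exact ⟨h1, fun h3 => lt_asymm (show R < _ from h2) h3⟩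

/-- Shifting a disc away from the origin strictly decreases its Gaussian measure. The reflection
`z ↦ c - z` exchanges the two discs; on the part of the centred disc outside the shifted one it
strictly increases the modulus, hence strictly decreases the density. -/
theorem planarGaussian_disc_lt {c : ℝ × ℝ} (hc : c ≠ 0) {R : ℝ} (hR : 0 < R) :
    planarGaussian.real (disc c R) < planarGaussian.real (disc 0 R) := by
  have hm0 := (isOpen_disc 0 R).measurableSet
  have hmc := (isOpen_disc c R).measurableSet
  have hswap : (fun z => c - z) ⁻¹' (disc c R \ disc 0 R) = disc 0 R \ disc c R := by
    ext z
    simp only [Set.mem_preimage, Set.mem_sdiff, disc, Set.mem_ofPred_eq, Prod.fst_sub, Prod.snd_sub,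
      Prod.fst_zero, Prod.snd_zero, sub_zero]
    ring_nf
  have hreflect : ∫ z in disc c R \ disc 0 R, planarDensity z
      = ∫ z in disc 0 R \ disc c R, planarDensity (c - z) := by
    rw [← hswap]
    exact ((Measure.measurePreserving_sub_left volume c).setIntegral_preimage_emb
      (MeasurableEquiv.subLeft c).measurableEmbedding _ _).symm
  have hint : Integrable fun z => planarDensity (c - z) :=
    integrable_planarDensity.comp_sub_left c
  have hlt : planarGaussian.real (disc c R \ disc 0 R)
      < planarGaussian.real (disc 0 R \ disc c R) := by
    rw [planarGaussian_real_apply (hmc.diff hm0), planarGaussian_real_apply (hm0.diff hmc),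
      hreflect, ← sub_pos, ← integral_sub integrable_planarDensity.integrableOn hint.integrableOn]
    have hpos : ∀ z ∈ disc 0 R \ disc c R, 0 < planarDensity z - planarDensity (c - z) := by
      rintro z ⟨h1, h2⟩
      simp only [disc, Set.mem_ofPred_eq, Prod.fst_zero, Prod.snd_zero, sub_zero, not_lt] at h1 h2
      rw [sub_pos]
      unfold planarDensity
      have := Real.pi_pos
      refine mul_lt_mul_of_pos_left (Real.exp_lt_exp.2 (neg_lt_neg ?_)) (by positivity)
      change z.1 ^ 2 + z.2 ^ 2 < (c.1 - z.1) ^ 2 + (c.2 - z.2) ^ 2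
      linarith [sq_nonneg (z.1 - c.1)]
    refine (setIntegral_pos_iff_support_of_nonneg_ae
      ((ae_restrict_iff' (hm0.diff hmc)).2 (.of_forall fun z hz => (hpos z hz).le))
      (integrable_planarDensity.sub hint).integrableOn).2 ?_
    have hsub : disc 0 R \ disc c R ⊆
        Function.support fun z => planarDensity z - planarDensity (c - z) :=
      fun z hz => (hpos z hz).ne'
    rw [Set.inter_eq_right.2 hsub]
    exact volume_disc_diff_pos hc hR
  have h1 := measureReal_sdiff_add_inter (μ := planarGaussian) (s := disc c R) hm0
  have h2 := measureReal_sdiff_add_inter (μ := planarGaussian) (s := disc 0 R) hmc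
  rw [Set.inter_comm] at h2
  linarith

theorem planarGaussian_disc_pos (c : ℝ × ℝ) {R : ℝ} (hR : 0 < R) :
    0 < planarGaussian.real (disc c R) := by
  have hm := (isOpen_disc c R).measurableSet
  rw [planarGaussian_real_apply hm]
  refine (setIntegral_pos_iff_support_of_nonneg_ae
    (.of_forall planarDensity_nonneg) integrable_planarDensity.integrableOn).2 ?_
  rw [Set.inter_eq_right.2]
  · exact (isOpen_disc c R).measure_pos volume ⟨c, by simpa [disc] using hR⟩
  · intro z _
    have := Real.pi_pos
    exact ne_of_gt (by unfold planarDensity; positivity)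

theorem ae_ne_zero_planarGaussian : ∀ᵐ z ∂planarGaussian, z ≠ 0 := by
  have : NullSingletonClass (gaussianReal 0 (1 / 2)) :=
    nullSingletonClass_gaussianReal (by norm_num)
  have h : ∀ᵐ a ∂gaussianReal 0 (1 / 2), a ≠ 0 :=
    compl_mem_ae_iff.2 (measure_singleton 0)
  have h' : ∀ᵐ z ∂planarGaussian, z.1 ≠ 0 := Measure.quasiMeasurePreserving_fst.ae h
  filter_upwards [h'] with z hz h0 using hz (by rw [h0]; rfl)

/-! ### Integration over the fibres of a product -/

theorem measureReal_prod_inter_eq_setIntegral {α β : Type*} [MeasurableSpace α] [MeasurableSpace β]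
    (τ : Measure α) (ν : Measure β) [IsProbabilityMeasure τ] [IsProbabilityMeasure ν]
    {A : Set α} (hA : MeasurableSet A) {B : Set (α × β)} (hB : MeasurableSet B) :
    (τ.prod ν).real (Prod.fst ⁻¹' A ∩ B) = ∫ w in A, ν.real (Prod.mk w ⁻¹' B) ∂τ := by
  have hmeas := measurable_measure_prodMk_left (ν := ν) hB
  have hfib (w : α) : ν (Prod.mk w ⁻¹' (Prod.fst ⁻¹' A ∩ B))
      = A.indicator (fun w => ν (Prod.mk w ⁻¹' B)) w := by
    by_cases hw : w ∈ A <;> simp [hw, Set.preimage_preimage]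
  simp_rw [measureReal_def]
  rw [integral_toReal hmeas.aemeasurable (.of_forall fun w => measure_lt_top _ _),
    Measure.prod_apply ((measurable_fst hA).inter hB), ← lintegral_indicator hA]
  simp_rw [hfib]

theorem setIntegral_pos_of_ae_pos {α : Type*} [MeasurableSpace α] {τ : Measure α} {A : Set α}
    {f : α → ℝ} (hf : ∀ᵐ w ∂τ, 0 < f w) (hint : IntegrableOn f A τ) (hA : 0 < τ A) :
    0 < ∫ w in A, f w ∂τ := by
  refine (setIntegral_pos_iff_support_of_nonneg_ae
    (ae_restrict_of_ae (hf.mono fun _ h => h.le)) hint).2 ?_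
  have h : (Function.support f ∩ A : Set α) =ᵐ[τ] A := by
    filter_upwards [hf] with w hw
    exact propext ⟨fun h => h.2, fun h => ⟨hw.ne', h⟩⟩
  rwa [measure_congr h]

/-! ### The outage event in normalized coordinates -/

/-- The squared modulus `|√(1 - m ^ 2) z + m w| ^ 2`, with planar vectors in place of complex
numbers. -/
noncomputable def correlatedGain (m : ℝ) (w z : ℝ × ℝ) : ℝ :=
  (√(1 - m ^ 2) * z.1 + m * w.1) ^ 2 + (√(1 - m ^ 2) * z.2 + m * w.2) ^ 2

theorem one_sub_sq_pos {m : ℝ} (hm : |m| < 1) : 0 < 1 - m ^ 2 :=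
  sub_pos.2 ((sq_lt_one_iff_abs_lt_one m).2 hm)

theorem setOf_correlatedGain_lt {m : ℝ} (hm : |m| < 1) (w : ℝ × ℝ) (X : ℝ) :
    {z | correlatedGain m w z < X} = disc (-(m / √(1 - m ^ 2)) • w) (X / (1 - m ^ 2)) := by
  have h := one_sub_sq_pos hm
  have hs : 0 < √(1 - m ^ 2) := Real.sqrt_pos.2 h
  have hs2 : √(1 - m ^ 2) ^ 2 = 1 - m ^ 2 := Real.sq_sqrt h.le
  ext z
  change _ < X ↔ (z.1 - -(m / √(1 - m ^ 2)) * w.1) ^ 2 + (z.2 - -(m / √(1 - m ^ 2)) * w.2) ^ 2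
    < X / (1 - m ^ 2)
  unfold correlatedGain
  generalize √(1 - m ^ 2) = s at hs hs2 ⊢
  rw [lt_div_iff₀ h, ← hs2]
  refine iff_of_eq (congrArg (· < X) ?_)
  field_simp
  ring

/-- The channel gain at port `k` in units of `σ ^ 2`, where `w k` is the pair `(x k, y k)`. -/
noncomputable def portGain (μ : ℕ → ℝ) (w : ℕ → ℝ × ℝ) (k : ℕ) : ℝ :=
  if k = 1 then (w 0).1 ^ 2 + (w 0).2 ^ 2 else correlatedGain (μ k) (w 0) (w k)

@[fun_prop]
theorem measurable_portGain (μ : ℕ → ℝ) (k : ℕ) : Measurable fun w => portGain μ w k := by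
  unfold portGain correlatedGain
  split_ifs <;> fun_prop

/-- The values of the source pairs for which the first `n` ports are all in outage, at a threshold
that is `X` times the average signal-to-noise ratio. -/
def outageSet (μ : ℕ → ℝ) (n : ℕ) (X : ℝ) : Set (ℕ → ℝ × ℝ) :=
  {w | ∀ k ∈ Finset.Icc 1 n, portGain μ w k < X}

theorem measurableSet_outageSet (μ : ℕ → ℝ) (n : ℕ) (X : ℝ) :
    MeasurableSet (outageSet μ n X) := by
  have h : outageSet μ n X = ⋂ k ∈ Finset.Icc 1 n, {w | portGain μ w k < X} := by
    ext w; simp [outageSet]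
  rw [h]
  exact Finset.measurableSet_biInter _ fun k _ =>
    measurableSet_lt (measurable_portGain μ k) measurable_const

theorem outageSet_one (μ : ℕ → ℝ) (X : ℝ) : outageSet μ 1 X = {w | w 0 ∈ disc 0 X} := by
  ext w
  simp [outageSet, portGain, disc]

theorem mem_outageSet_succ {μ : ℕ → ℝ} {n : ℕ} (hn : 1 ≤ n) {X : ℝ} {w : ℕ → ℝ × ℝ} :
    w ∈ outageSet μ (n + 1) X ↔
      w ∈ outageSet μ n X ∧ correlatedGain (μ (n + 1)) (w 0) (w (n + 1)) < X := by
  have h : portGain μ w (n + 1) = correlatedGain (μ (n + 1)) (w 0) (w (n + 1)) :=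
    if_neg (by omega)
  unfold outageSet
  rw [← Finset.insert_Icc_right_eq_Icc_add_one (by omega : 1 ≤ n + 1)]
  simp only [Set.mem_ofPred_eq, Finset.forall_mem_insert, h]
  exact and_comm

theorem mem_outageSet_congr {μ : ℕ → ℝ} {n : ℕ} {X : ℝ} {v w : ℕ → ℝ × ℝ}
    (h : ∀ k ≤ n, v k = w k) : v ∈ outageSet μ n X ↔ w ∈ outageSet μ n X := by
  refine forall₂_congr fun k hk => ?_
  unfold portGain
  rw [h 0 (Nat.zero_le n), h k (Finset.mem_Icc.1 hk).2]

theorem norm_channel_sq {Ω : Type*} (σ : ℝ) (μ : ℕ → ℝ) (x y : ℕ → Ω → ℝ) (k : ℕ) (ω : Ω) :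
    ‖channel σ μ x y k ω‖ ^ 2 = σ ^ 2 * portGain μ (fun i => (x i ω, y i ω)) k := by
  rw [Complex.sq_norm, Complex.normSq_apply]
  unfold channel portGain correlatedGain
  split_ifs <;> (dsimp only; ring)

theorem avgSNR_pos {σ Es ση : ℝ} (hσ : 0 < σ) (hEs : 0 < Es) (hση : 0 < ση) :
    0 < avgSNR σ Es ση := by
  unfold avgSNR transmitSNR
  positivity

theorem outageProb_eq {Ω : Type*} [MeasurableSpace Ω] (P : Measure Ω) {n : ℕ} (hn : 1 ≤ n)
    {σ Es ση : ℝ} (hσ : 0 < σ) (hEs : 0 < Es) (hση : 0 < ση) (μ : ℕ → ℝ) (x y : ℕ → Ω → ℝ)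
    (γ : ℝ) :
    outageProb P n σ Es ση μ x y γ
      = P.real {ω | (fun k => (x k ω, y k ω)) ∈ outageSet μ n (γ / avgSNR σ Es ση)} := by
  have hΓ := avgSNR_pos hσ hEs hση
  have hΘ : 0 < transmitSNR Es ση := by unfold transmitSNR; positivity
  unfold outageProb
  congr 1
  ext ω
  have hport (k : ℕ) : ‖channel σ μ x y k ω‖ ^ 2 * transmitSNR Es ση < γ ↔
      portGain μ (fun i => (x i ω, y i ω)) k < γ / avgSNR σ Es ση := by
    rw [lt_div_iff₀ hΓ, norm_channel_sq]
    unfold avgSNR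
    refine iff_of_eq (congrArg (· < γ) ?_)
    ring
  have : Nonempty (Set.Icc 1 n) := ⟨⟨1, le_rfl, hn⟩⟩
  change gFAS n σ μ x y ω ^ 2 * transmitSNR Es ση < γ ↔ ∀ k ∈ Finset.Icc 1 n, _ < _
  simp_rw [← hport]
  constructor
  · intro h k hk
    refine lt_of_le_of_lt ?_ h
    have hle : ‖channel σ μ x y k ω‖ ≤ gFAS n σ μ x y ω :=
      le_ciSup (f := fun k : Set.Icc 1 n => ‖channel σ μ x y k ω‖) (Set.finite_range _).bddAbove
        ⟨k, Finset.mem_Icc.1 hk⟩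
    gcongr
  · intro h
    obtain ⟨k, hk⟩ :=
      exists_eq_ciSup_of_finite (f := fun k : Set.Icc 1 n => ‖channel σ μ x y k ω‖)
    unfold gFAS
    rw [← hk]
    exact h k (Finset.mem_Icc.2 k.2)

/-! ### Adding one port -/

section Source

variable {Ω : Type*} [MeasurableSpace Ω] {P : Measure Ω} {N : ℕ} {x y : ℕ → Ω → ℝ}

theorem IsGaussianSource.aemeasurable_sumElim (h : IsGaussianSource P N x y)
    (i : Fin (N + 1) ⊕ Fin (N + 1)) :
    AEMeasurable (Sum.elim (fun k : Fin (N + 1) => x k) (fun k : Fin (N + 1) => y k) i) P := by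
  rcases i with k | k
  · exact (h.law_x k (Nat.lt_succ_iff.1 k.2)).aemeasurable
  · exact (h.law_y k (Nat.lt_succ_iff.1 k.2)).aemeasurable

theorem IsGaussianSource.hasLaw_pair [IsFiniteMeasure P] (h : IsGaussianSource P N x y) {k : ℕ}
    (hk : k ≤ N) : HasLaw (fun ω => (x k ω, y k ω)) planarGaussian P where
  aemeasurable := (h.law_x k hk).aemeasurable.prodMk (h.law_y k hk).aemeasurable
  map_eq := by
    have hind : IndepFun (x k) (y k) P :=
      h.indep.indepFun (i := Sum.inl ⟨k, Nat.lt_succ_iff.2 hk⟩)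
        (j := Sum.inr ⟨k, Nat.lt_succ_iff.2 hk⟩) Sum.inl_ne_inr
    rw [hind.map_prod_eq_prod_map_map (h.law_x k hk).aemeasurable (h.law_y k hk).aemeasurable,
      (h.law_x k hk).map_eq, (h.law_y k hk).map_eq, planarGaussian]

/-- The source pairs with index at most `n`; the others are replaced by `0`. -/
def truncatedSource (x y : ℕ → Ω → ℝ) (n : ℕ) (ω : Ω) (k : ℕ) : ℝ × ℝ :=
  if k ≤ n then (x k ω, y k ω) else 0

theorem IsGaussianSource.aemeasurable_truncatedSource (h : IsGaussianSource P N x y) {n : ℕ}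
    (hn : n ≤ N) : AEMeasurable (truncatedSource x y n) P := by
  refine aemeasurable_pi_iff.2 fun k => ?_
  unfold truncatedSource
  split_ifs with hk
  · exact (h.law_x k (hk.trans hn)).aemeasurable.prodMk (h.law_y k (hk.trans hn)).aemeasurable
  · exact aemeasurable_const

theorem IsGaussianSource.indepFun_truncatedSource (h : IsGaussianSource P N x y) {n : ℕ}
    (hn : n + 1 ≤ N) :
    IndepFun (truncatedSource x y n) (fun ω => (x (n + 1) ω, y (n + 1) ω)) P := by
  classical
  let idx : Fin (N + 1) ⊕ Fin (N + 1) → ℕ := Sum.elim (fun k => k) (fun k => k)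
  let S : Finset (Fin (N + 1) ⊕ Fin (N + 1)) := Finset.univ.filter fun i => idx i ≤ n
  let T : Finset (Fin (N + 1) ⊕ Fin (N + 1)) := Finset.univ.filter fun i => idx i = n + 1
  have hST : Disjoint S T := by
    refine Finset.disjoint_left.2 fun i hi hi' => ?_
    have h1 := (Finset.mem_filter.1 hi).2
    have h2 := (Finset.mem_filter.1 hi').2
    omega
  have hind := h.indep.indepFun_finset₀ S T hST h.aemeasurable_sumElim
  let φ : (S → ℝ) → ℕ → ℝ × ℝ := fun w k =>
    if hk : k ≤ n then
      (w ⟨Sum.inl ⟨k, by omega⟩, by simpa [S, idx] using hk⟩,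
        w ⟨Sum.inr ⟨k, by omega⟩, by simpa [S, idx] using hk⟩)
    else 0
  let ψ : (T → ℝ) → ℝ × ℝ := fun w =>
    (w ⟨Sum.inl ⟨n + 1, by omega⟩, by simp [T, idx]⟩,
      w ⟨Sum.inr ⟨n + 1, by omega⟩, by simp [T, idx]⟩)
  have hφ : Measurable φ := by
    refine measurable_pi_iff.2 fun k => ?_
    by_cases hk : k ≤ n
    · simp only [φ, hk, dite_true]
      fun_prop
    · simp only [φ, hk, dite_false]
      fun_prop
  have hψ : Measurable ψ := by fun_prop
  have hcomp : φ ∘ (fun ω (i : S) => Sum.elim (fun k : Fin (N + 1) => x k)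
      (fun k : Fin (N + 1) => y k) i ω) = truncatedSource x y n := by
    funext ω k
    by_cases hk : k ≤ n <;> simp [truncatedSource, φ, hk]
  rw [← hcomp]
  exact hind.comp hφ hψ

variable {μ : ℕ → ℝ} {X : ℝ}

theorem IsGaussianSource.outage_one [IsFiniteMeasure P] (h : IsGaussianSource P N x y)
    (hX : 0 < X) :
    P.real {ω | (fun k => (x k ω, y k ω)) ∈ outageSet μ 1 X} = 1 - Real.exp (-X) := by
  rw [outageSet_one, ← planarGaussian_disc_zero hX]
  exact (h.hasLaw_pair (Nat.zero_le N)).measureReal_eq (p := fun z => z ∈ disc 0 X)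
    (isOpen_disc 0 X).measurableSet

theorem IsGaussianSource.outage_eq_truncatedSource (h : IsGaussianSource P N x y) {n : ℕ}
    (hn : n ≤ N) :
    P.real {ω | (fun k => (x k ω, y k ω)) ∈ outageSet μ n X}
      = (P.map (truncatedSource x y n)).real (outageSet μ n X) := by
  rw [map_measureReal_apply_of_aemeasurable (h.aemeasurable_truncatedSource hn)
    (measurableSet_outageSet μ n X)]
  congr 1
  ext ω
  exact mem_outageSet_congr fun k hk => by simp [truncatedSource, hk]

/-- Conditioning on the source pairs of the first `n` ports: the port `n + 1` is in outage exactly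
if its own, independent pair falls into a disc whose centre is determined by the pair of index
`0`. -/
theorem IsGaussianSource.outage_succ [IsProbabilityMeasure P] (h : IsGaussianSource P N x y)
    {n : ℕ} (h1 : 1 ≤ n) (hn : n + 1 ≤ N) (hμ : |μ (n + 1)| < 1) :
    P.real {ω | (fun k => (x k ω, y k ω)) ∈ outageSet μ (n + 1) X}
      = ∫ w in outageSet μ n X,
          planarGaussian.real (disc (-(μ (n + 1) / √(1 - μ (n + 1) ^ 2)) • w 0)
            (X / (1 - μ (n + 1) ^ 2))) ∂P.map (truncatedSource x y n) := by
  have hW := h.aemeasurable_truncatedSource (n := n) (by omega)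
  have hZ := h.hasLaw_pair hn
  have : IsProbabilityMeasure (P.map (truncatedSource x y n)) :=
    Measure.isProbabilityMeasure_map hW
  have hA := measurableSet_outageSet μ n X
  let B : Set ((ℕ → ℝ × ℝ) × (ℝ × ℝ)) := {p | correlatedGain (μ (n + 1)) (p.1 0) p.2 < X}
  have hB : MeasurableSet B := by
    refine measurableSet_lt ?_ measurable_const
    unfold correlatedGain
    fun_prop
  have hmap := (h.indepFun_truncatedSource hn).map_prod_eq_prod_map_map hW hZ.aemeasurable
  rw [hZ.map_eq] at hmap
  simp_rw [← setOf_correlatedGain_lt hμ]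
  refine Eq.trans ?_ (measureReal_prod_inter_eq_setIntegral _ planarGaussian hA hB)
  rw [← hmap, map_measureReal_apply_of_aemeasurable (hW.prodMk hZ.aemeasurable)
    ((measurable_fst hA).inter hB)]
  congr 1
  ext ω
  refine (mem_outageSet_succ h1).trans (and_congr ?_ ?_)
  · exact mem_outageSet_congr fun k hk => by simp [truncatedSource, hk]
  · simp [B, truncatedSource]

/-- Adding a port to an antenna with positive outage probability keeps that probability positive
and multiplies it by at most `1 - exp (-X / (1 - m ^ 2))`, where `m` is the parameter of the new
port; the bound is strict if `m ≠ 0`. -/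
theorem IsGaussianSource.outage_succ_bounds [IsProbabilityMeasure P]
    (h : IsGaussianSource P N x y) {n : ℕ} (h1 : 1 ≤ n) (hn : n + 1 ≤ N) (hμ : |μ (n + 1)| < 1) (hX : 0 < X)
    (hpos : 0 < P.real {ω | (fun k => (x k ω, y k ω)) ∈ outageSet μ n X}) :
    0 < P.real {ω | (fun k => (x k ω, y k ω)) ∈ outageSet μ (n + 1) X} ∧
    P.real {ω | (fun k => (x k ω, y k ω)) ∈ outageSet μ (n + 1) X}
      ≤ P.real {ω | (fun k => (x k ω, y k ω)) ∈ outageSet μ n X}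
        * (1 - Real.exp (-(X / (1 - μ (n + 1) ^ 2)))) ∧
    (μ (n + 1) ≠ 0 → P.real {ω | (fun k => (x k ω, y k ω)) ∈ outageSet μ (n + 1) X}
      < P.real {ω | (fun k => (x k ω, y k ω)) ∈ outageSet μ n X}
        * (1 - Real.exp (-(X / (1 - μ (n + 1) ^ 2))))) := by
  have hs := one_sub_sq_pos hμ
  have hW := h.aemeasurable_truncatedSource (n := n) (by omega)
  have : IsProbabilityMeasure (P.map (truncatedSource x y n)) :=
    Measure.isProbabilityMeasure_map hW
  rw [h.outage_succ h1 hn hμ]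
  rw [h.outage_eq_truncatedSource (by omega)] at hpos ⊢
  set τ := P.map (truncatedSource x y n)
  set A := outageSet μ n X
  set R := X / (1 - μ (n + 1) ^ 2)
  have hR : 0 < R := div_pos hX hs
  set a := -(μ (n + 1) / √(1 - μ (n + 1) ^ 2))
  set G : (ℕ → ℝ × ℝ) → ℝ := fun w => planarGaussian.real (disc (a • w 0) R)
  have hGle (w : ℕ → ℝ × ℝ) : G w ≤ 1 - Real.exp (-R) := by
    rw [← planarGaussian_disc_zero hR]
    rcases eq_or_ne (a • w 0) 0 with h0 | h0
    · exact (congrArg (fun c => planarGaussian.real (disc c R)) h0).le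
    · exact (planarGaussian_disc_lt h0 hR).le
  have hGmeas : Measurable G := by
    have hB : MeasurableSet {p : (ℕ → ℝ × ℝ) × (ℝ × ℝ) | p.2 ∈ disc (a • p.1 0) R} := by
      change MeasurableSet {p : (ℕ → ℝ × ℝ) × (ℝ × ℝ) |
        (p.2.1 - a * (p.1 0).1) ^ 2 + (p.2.2 - a * (p.1 0).2) ^ 2 < R}
      exact measurableSet_lt (by fun_prop) measurable_const
    exact (measurable_measure_prodMk_left (ν := planarGaussian) hB).ennreal_toReal
  have hGint : Integrable G τ :=
    Integrable.of_bound hGmeas.aestronglyMeasurable 1 (Filter.Eventually.of_forall fun w => by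
      rw [Real.norm_of_nonneg measureReal_nonneg]
      exact measureReal_le_one)
  have hτA : 0 < τ A := (ENNReal.toReal_pos_iff.1 hpos).1
  have hconst : τ.real A * (1 - Real.exp (-R)) = ∫ _ in A, (1 - Real.exp (-R)) ∂τ := by
    rw [setIntegral_const, smul_eq_mul]
  refine ⟨setIntegral_pos_of_ae_pos (.of_forall fun w => planarGaussian_disc_pos _ hR)
    hGint.integrableOn hτA, ?_, fun hm => ?_⟩
  · rw [hconst]
    exact setIntegral_mono hGint.integrableOn (integrable_const _).integrableOn hGle
  · have ha : a ≠ 0 := neg_ne_zero.2 (div_ne_zero hm (Real.sqrt_pos.2 hs).ne')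
    have hw0 : ∀ᵐ w ∂τ, w 0 ≠ 0 := by
      refine (ae_map_iff hW ((measurableSet_singleton (0 : ℝ × ℝ)).compl.preimage
        (measurable_pi_apply 0))).2 ?_
      have hlaw := h.hasLaw_pair (Nat.zero_le N)
      have := ae_ne_zero_planarGaussian
      rw [← hlaw.map_eq] at this
      filter_upwards [ae_of_ae_map hlaw.aemeasurable this] with ω hω
      simpa [truncatedSource] using hω
    rw [hconst, ← sub_pos, ← integral_sub (integrable_const _).integrableOn hGint.integrableOn]
    refine setIntegral_pos_of_ae_pos ?_ ((integrable_const _).sub hGint).integrableOn hτA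
    filter_upwards [hw0] with w hw
    rw [sub_pos, ← planarGaussian_disc_zero hR]
    exact planarGaussian_disc_lt (smul_ne_zero ha hw) hR

/-- Each port after the first `n` multiplies the outage probability by at most its conditional
outage probability given that the reference channel vanishes. -/
theorem IsGaussianSource.outage_le_mul_prod [IsProbabilityMeasure P]
    (h : IsGaussianSource P N x y) (hX : 0 < X)
    (hμ : ∀ k ∈ Finset.Icc 2 N, |μ k| < 1) {n : ℕ} (h1 : 1 ≤ n)
    (hpos : 0 < P.real {ω | (fun k => (x k ω, y k ω)) ∈ outageSet μ n X}) {l : ℕ} (hnl : n ≤ l)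
    (hl : l ≤ N) :
    0 < P.real {ω | (fun k => (x k ω, y k ω)) ∈ outageSet μ l X} ∧
    P.real {ω | (fun k => (x k ω, y k ω)) ∈ outageSet μ l X}
      ≤ P.real {ω | (fun k => (x k ω, y k ω)) ∈ outageSet μ n X}
        * ∏ k ∈ Finset.Icc (n + 1) l, (1 - Real.exp (-(X / (1 - μ k ^ 2)))) := by
  induction l, hnl using Nat.le_induction with
  | base => simpa using hpos
  | succ l hnl ih =>
    obtain ⟨hp, hle⟩ := ih (by omega)
    have hμl := hμ (l + 1) (Finset.mem_Icc.2 ⟨by omega, hl⟩)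
    obtain ⟨hp', hle', -⟩ := h.outage_succ_bounds (h1.trans hnl) hl hμl hX hp
    refine ⟨hp', hle'.trans ?_⟩
    rw [Finset.prod_Icc_succ_top (by omega), ← mul_assoc]
    refine mul_le_mul_of_nonneg_right hle (sub_nonneg.2 (Real.exp_le_one_iff.2 ?_))
    exact neg_nonpos.2 (div_pos hX (one_sub_sq_pos hμl)).le

end Source

/-! ### Comparison with the port factors -/

theorem le_portFactor_of_log_le {κ m X : ℝ} (hκ : 1 < κ) (hm0 : m ≠ 0)
    (h : Real.log (rho κ / √|m|) ≤ (κ - 1) / (1 - m ^ 2) * X) :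
    1 - Real.exp (-(X / (1 - m ^ 2))) ≤ portFactor κ m X := by
  have hpos : 0 < rho κ / √|m| := div_pos (rho_pos hκ) (Real.sqrt_pos.2 (abs_pos.2 hm0))
  have h1 : rho κ / √|m| ≤ Real.exp ((κ - 1) / (1 - m ^ 2) * X) :=
    (Real.log_le_iff_le_exp hpos).1 h
  refine sub_le_sub_left ?_ 1
  calc rho κ / √|m| * Real.exp (-(κ / (1 - m ^ 2) * X))
      ≤ Real.exp ((κ - 1) / (1 - m ^ 2) * X) * Real.exp (-(κ / (1 - m ^ 2) * X)) := by gcongr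
    _ = Real.exp (-(X / (1 - m ^ 2))) := by
        rw [← Real.exp_add]
        congr 1
        ring

theorem exp_neg_mul_lt {κ m X : ℝ} (hκ : 1 < κ) (hm : |m| < 1) (hX : 0 < X) :
    Real.exp (-(κ / (1 - m ^ 2) * X)) < Real.exp (-(X / (1 - m ^ 2))) := by
  have h := div_pos hX (one_sub_sq_pos hm)
  rw [Real.exp_lt_exp, neg_lt_neg_iff, div_mul_eq_mul_div, mul_div_assoc]
  exact lt_mul_of_one_lt_left h hκ

/-- A port factor that is positive at every positive threshold has `ϱ ≤ √|m|`, by passing to the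
limit of vanishing thresholds. -/
theorem lt_portFactor_of_pos {κ m Γ X : ℝ} (hκ : 1 < κ) (hm : |m| < 1) (hX : 0 < X)
    (h : ∀ γ : ℝ, 0 < γ → 0 < portFactor κ m (γ / Γ)) :
    1 - Real.exp (-(X / (1 - m ^ 2))) < portFactor κ m X := by
  have hle : rho κ / √|m| ≤ 1 := by
    have hcont : Continuous fun γ : ℝ => portFactor κ m (γ / Γ) := by
      unfold portFactor
      fun_prop
    have h0 : 0 ≤ portFactor κ m (0 / Γ) :=
      ge_of_tendsto ((hcont.tendsto 0).mono_left nhdsWithin_le_nhds)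
        (eventually_nhdsWithin_of_forall fun γ hγ => (h γ hγ).le : ∀ᶠ γ in nhdsWithin 0 (Set.Ioi 0),
          0 ≤ portFactor κ m (γ / Γ))
    simpa [portFactor] using h0
  refine sub_lt_sub_left (lt_of_le_of_lt ?_ (exp_neg_mul_lt hκ hm hX)) 1
  exact mul_le_of_le_one_left (Real.exp_pos _).le hle

theorem lt_modifiedPortFactor {κ m X : ℝ} (hκ : 1 < κ) (hm : |m| < 1) (hX : 0 < X) :
    1 - Real.exp (-(X / (1 - m ^ 2))) < modifiedPortFactor κ m X := by
  refine sub_lt_sub_left (lt_of_le_of_lt ?_ (exp_neg_mul_lt hκ hm hX)) 1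
  exact mul_le_of_le_one_left (Real.exp_pos _).le (by linarith [rho_lt_half hκ])

theorem one_sub_exp_neg_div_pos {m X : ℝ} (hm : |m| < 1) (hX : 0 < X) :
    0 < 1 - Real.exp (-(X / (1 - m ^ 2))) :=
  sub_pos.2 (Real.exp_lt_one_iff.2 (neg_neg_of_pos (div_pos hX (one_sub_sq_pos hm))))

end FluidAntenna

/-! ### The upper bounds -/

open FluidAntenna in
theorem theorem7
    {Ω : Type*} [MeasurableSpace Ω] (P : Measure Ω) [IsProbabilityMeasure P]
    (N : ℕ) (hN : 2 ≤ N)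
    (σ Es ση : ℝ) (hσ : 0 < σ) (hEs : 0 < Es) (hση : 0 < ση)
    (μ : ℕ → ℝ) (hμ : ∀ k ∈ Finset.Icc 2 N, |μ k| < 1)
    (x y : ℕ → Ω → ℝ) (hxy : FluidAntenna.IsGaussianSource P N x y)
    (κ : ℝ) (hκ : 1 < κ) :
    (0 < FluidAntenna.rho κ ∧ FluidAntenna.rho κ < 1 / 2) ∧
    -- the bound, when all factors are positive whatever the threshold
    ((∀ k ∈ Finset.Icc 2 N, μ k ≠ 0 ∧
        ∀ γ : ℝ, 0 < γ → 0 < FluidAntenna.portFactor κ (μ k) (γ / FluidAntenna.avgSNR σ Es ση)) →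
      ∀ γ : ℝ, 0 < γ →
        FluidAntenna.outageProb P N σ Es ση μ x y γ
          < FluidAntenna.outageUB κ N μ (γ / FluidAntenna.avgSNR σ Es ση)) ∧
    -- the bound at one threshold that is large enough, given the parameters
    (∀ γ : ℝ, 0 < γ →
      (∀ k ∈ Finset.Icc 2 N, μ k ≠ 0 ∧
        Real.log (FluidAntenna.rho κ / √|μ k|)
          ≤ (κ - 1) / (1 - μ k ^ 2) * (γ / FluidAntenna.avgSNR σ Es ση)) →
      FluidAntenna.outageProb P N σ Es ση μ x y γ
        < FluidAntenna.outageUB κ N μ (γ / FluidAntenna.avgSNR σ Es ση)) ∧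
    -- the bound with modified factors for an arbitrary set of ports
    (∀ S : Finset ℕ,
      (∀ k ∈ Finset.Icc 2 N, k ∉ S → μ k ≠ 0 ∧
        ∀ γ : ℝ, 0 < γ → 0 < FluidAntenna.portFactor κ (μ k) (γ / FluidAntenna.avgSNR σ Es ση)) →
      ∀ γ : ℝ, 0 < γ →
        FluidAntenna.outageProb P N σ Es ση μ x y γ
          < FluidAntenna.modifiedOutageUB κ N S μ (γ / FluidAntenna.avgSNR σ Es ση)) ∧
    -- the tighter bound that starts from the exact outage probability of two ports
    ((∀ k ∈ Finset.Icc 2 N, μ k ≠ 0 ∧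
        ∀ γ : ℝ, 0 < γ → 0 < FluidAntenna.portFactor κ (μ k) (γ / FluidAntenna.avgSNR σ Es ση)) →
      ∀ γ : ℝ, 0 < γ →
        (3 ≤ N →
          FluidAntenna.outageProb P N σ Es ση μ x y γ
            < FluidAntenna.outageProb P 2 σ Es ση μ x y γ *
              ∏ k ∈ Finset.Icc 3 N,
                FluidAntenna.portFactor κ (μ k) (γ / FluidAntenna.avgSNR σ Es ση)) ∧
        FluidAntenna.outageProb P 2 σ Es ση μ x y γ *
            ∏ k ∈ Finset.Icc 3 N,
              FluidAntenna.portFactor κ (μ k) (γ / FluidAntenna.avgSNR σ Es ση)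
          < FluidAntenna.outageUB κ N μ (γ / FluidAntenna.avgSNR σ Es ση)) := by
  have hΓ := avgSNR_pos hσ hEs hση
  have h2N : 2 ∈ Finset.Icc 2 N := Finset.mem_Icc.2 ⟨le_rfl, hN⟩
  have hsub : ∀ k ∈ Finset.Icc 3 N, k ∈ Finset.Icc 2 N := fun k hk =>
    Finset.Icc_subset_Icc_left (by norm_num) hk
  have hsplit (f : ℕ → ℝ) : ∏ k ∈ Finset.Icc 2 N, f k = f 2 * ∏ k ∈ Finset.Icc 3 N, f k := by
    rw [← Finset.prod_Ioc_mul_eq_prod_Icc hN, mul_comm, ← Finset.Icc_succ_left_eq_Ioc]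
    rfl
  -- `q γ k` bounds the conditional outage probability of port `k`; it is attained if the reference
  -- channel vanishes.
  let q : ℝ → ℕ → ℝ := fun γ k => 1 - Real.exp (-(γ / avgSNR σ Es ση / (1 - μ k ^ 2)))
  have hq {γ : ℝ} (hγ : 0 < γ) : ∀ k ∈ Finset.Icc 2 N, 0 < q γ k := fun k hk =>
    one_sub_exp_neg_div_pos (hμ k hk) (div_pos hγ hΓ)
  have hone {γ : ℝ} (hγ : 0 < γ) : 0 < 1 - Real.exp (-(γ / avgSNR σ Es ση)) :=
    sub_pos.2 (Real.exp_lt_one_iff.2 (neg_neg_of_pos (div_pos hγ hΓ)))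
  have hpos1 {γ : ℝ} (hγ : 0 < γ) : 0 < P.real
      {ω | (fun k => (x k ω, y k ω)) ∈ outageSet μ 1 (γ / avgSNR σ Es ση)} := by
    rw [hxy.outage_one (div_pos hγ hΓ)]
    exact hone hγ
  have hpos {γ : ℝ} (hγ : 0 < γ) : 0 < outageProb P 2 σ Es ση μ x y γ := by
    rw [outageProb_eq P one_le_two hσ hEs hση]
    exact (hxy.outage_le_mul_prod (div_pos hγ hΓ) hμ le_rfl (hpos1 hγ) one_le_two hN).1
  have htwo {γ : ℝ} (hγ : 0 < γ) (h0 : μ 2 ≠ 0) : outageProb P 2 σ Es ση μ x y γ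
      < (1 - Real.exp (-(γ / avgSNR σ Es ση))) * q γ 2 := by
    rw [outageProb_eq P one_le_two hσ hEs hση, ← hxy.outage_one (μ := μ) (div_pos hγ hΓ)]
    exact (hxy.outage_succ_bounds le_rfl hN (hμ 2 h2N) (div_pos hγ hΓ) (hpos1 hγ)).2.2 h0
  have hfromOne {γ : ℝ} (hγ : 0 < γ) : outageProb P N σ Es ση μ x y γ
      ≤ (1 - Real.exp (-(γ / avgSNR σ Es ση))) * ∏ k ∈ Finset.Icc 2 N, q γ k := by
    rw [outageProb_eq P (by omega) hσ hEs hση, ← hxy.outage_one (μ := μ) (div_pos hγ hΓ)]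
    exact (hxy.outage_le_mul_prod (div_pos hγ hΓ) hμ le_rfl (hpos1 hγ) (by omega) le_rfl).2
  have hfromTwo {γ : ℝ} (hγ : 0 < γ) : outageProb P N σ Es ση μ x y γ
      ≤ outageProb P 2 σ Es ση μ x y γ * ∏ k ∈ Finset.Icc 3 N, q γ k := by
    have h2 := hpos hγ
    rw [outageProb_eq P one_le_two hσ hEs hση] at h2 ⊢
    rw [outageProb_eq P (by omega) hσ hEs hση]
    exact (hxy.outage_le_mul_prod (div_pos hγ hΓ) hμ one_le_two h2 hN le_rfl).2
  have hlarge : ∀ γ : ℝ, 0 < γ →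
      (∀ k ∈ Finset.Icc 2 N, μ k ≠ 0 ∧
        Real.log (rho κ / √|μ k|) ≤ (κ - 1) / (1 - μ k ^ 2) * (γ / avgSNR σ Es ση)) →
      outageProb P N σ Es ση μ x y γ < outageUB κ N μ (γ / avgSNR σ Es ση) := by
    intro γ hγ h
    -- The factors may equal `q γ k` here, so strictness has to come from the port `2`.
    calc outageProb P N σ Es ση μ x y γ
        ≤ outageProb P 2 σ Es ση μ x y γ * ∏ k ∈ Finset.Icc 3 N, q γ k := hfromTwo hγ
      _ < (1 - Real.exp (-(γ / avgSNR σ Es ση))) * q γ 2 * ∏ k ∈ Finset.Icc 3 N, q γ k :=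
          mul_lt_mul_of_pos_right (htwo hγ (h 2 h2N).1)
            (Finset.prod_pos fun k hk => hq hγ k (hsub k hk))
      _ = (1 - Real.exp (-(γ / avgSNR σ Es ση))) * ∏ k ∈ Finset.Icc 2 N, q γ k := by
          rw [hsplit, mul_assoc]
      _ ≤ outageUB κ N μ (γ / avgSNR σ Es ση) :=
          mul_le_mul_of_nonneg_left (Finset.prod_le_prod (fun k hk => (hq hγ k hk).le)
            fun k hk => le_portFactor_of_log_le hκ (h k hk).1 (h k hk).2) (hone hγ).le
  have hmod : ∀ S : Finset ℕ,
      (∀ k ∈ Finset.Icc 2 N, k ∉ S → μ k ≠ 0 ∧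
        ∀ γ : ℝ, 0 < γ → 0 < portFactor κ (μ k) (γ / avgSNR σ Es ση)) →
      ∀ γ : ℝ, 0 < γ →
        outageProb P N σ Es ση μ x y γ < modifiedOutageUB κ N S μ (γ / avgSNR σ Es ση) := by
    intro S h γ hγ
    refine (hfromOne hγ).trans_lt (mul_lt_mul_of_pos_left
      (Finset.prod_lt_prod_of_nonempty (hq hγ) (fun k hk => ?_) ⟨2, h2N⟩) (hone hγ))
    split_ifs with hS
    · exact lt_modifiedPortFactor hκ (hμ k hk) (div_pos hγ hΓ)
    · exact lt_portFactor_of_pos hκ (hμ k hk) (div_pos hγ hΓ) (h k hk hS).2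
  refine ⟨⟨rho_pos hκ, rho_lt_half hκ⟩, fun h γ hγ => ?_, hlarge, hmod, fun h γ hγ => ?_⟩
  · simpa [modifiedOutageUB, outageUB] using hmod ∅ (fun k hk _ => h k hk) γ hγ
  · have hf : ∀ k ∈ Finset.Icc 2 N, q γ k < portFactor κ (μ k) (γ / avgSNR σ Es ση) :=
      fun k hk => lt_portFactor_of_pos hκ (hμ k hk) (div_pos hγ hΓ) (h k hk).2
    refine ⟨fun h3 => (hfromTwo hγ).trans_lt (mul_lt_mul_of_pos_left
      (Finset.prod_lt_prod_of_nonempty (fun k hk => hq hγ k (hsub k hk))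
        (fun k hk => hf k (hsub k hk)) ⟨3, Finset.mem_Icc.2 ⟨le_rfl, h3⟩⟩) (hpos hγ)), ?_⟩
    unfold outageUB
    rw [hsplit, ← mul_assoc]
    refine mul_lt_mul_of_pos_right ((htwo hγ (h 2 h2N).1).trans ?_)
      (Finset.prod_pos fun k hk => (h k (hsub k hk)).2 γ hγ)
    exact mul_lt_mul_of_pos_left (hf 2 h2N) (hone hγ)
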